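/- For a real number $\alpha>0$ let $S(\alpha)=\{(x,y)\in\mathbb{R}^2 : 0\le y\le \alpha x\}$. A packing polynomial on $S(\alpha)$ is a polynomial $P\in\mathbb{R}[x,y]$ that maps $S(\alpha)\cap\mathbb{Z}^2$ bijectively onto the set $\mathbb{N}_0=\{0,1,2,\dots\}$ of non-negative integers; it is called quadratic if its total degree is $2$. If $\alpha>0$ is irrational, then there is no quadratic packing polynomial on $S(\alpha)$. -/

import Mathlib

/-- The sector `S(α) = {(x, y) ∈ ℝ² | 0 ≤ y ≤ α x}`. -/
def sector (α : ℝ) : Set (ℝ × ℝ) :=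
  {p | 0 ≤ p.2 ∧ p.2 ≤ α * p.1}

/-- The integer lattice `ℤ²` as a subset of `ℝ²`. -/
def integerLattice : Set (ℝ × ℝ) :=
  Set.range fun p : ℤ × ℤ => ((p.1 : ℝ), (p.2 : ℝ))

/-- A real polynomial in two variables is a packing polynomial on `S(α)` if it maps the
integer lattice points of `S(α)` bijectively onto the non-negative integers. -/
def IsPackingPolynomial (α : ℝ) (P : MvPolynomial (Fin 2) ℝ) : Prop :=
  Set.BijOn (fun p : ℝ × ℝ => MvPolynomial.eval ![p.1, p.2] P)
    (sector α ∩ integerLattice) (Set.range ((↑) : ℕ → ℝ))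

/-- A packing polynomial that is quadratic, i.e. of total degree exactly two. -/
def IsQuadraticPackingPolynomial (α : ℝ) (P : MvPolynomial (Fin 2) ℝ) : Prop :=
  P.totalDegree = 2 ∧ IsPackingPolynomial α P

/-!
A quadratic polynomial with integral values on the lattice points of a sector with irrational
slope `α` has half-integral coefficients, so doubling it and dropping the constant term gives
`R = a x² + 2 b x y + c y² + e x + f y` with integers `a, b, c, e, f`. It is enough to see that
the original polynomial cannot enumerate the natural numbers.

* If `b² ≠ a c`, the level curves of `R` are conics with a centre. Multiplying the position vector
  of a lattice point by two conjugate elements `t ± J` of the quadratic algebra attached to the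
  form (in the model case `x² + y²`, by `t + i` and `t - i`) gives two points on the same level
  curve. For suitable large `t` both are lattice points of the sector, so `R` is not injective
  (`not_injOn_of_disc_ne_zero`).
* If `b² = a c`, the quadratic part vanishes along a rational direction, which is not on the upper
  edge of the sector since `α` is irrational. If it points into the sector or along the `x`-axis,
  `R` is affine along it, and again it is not injective (`not_injOn_of_kernel_mem`).
* Otherwise, unimodular coordinates turn the polynomial into `κ u² + β u + γ v + δ` and the
  sector into a cone `l u ≤ v ≤ r u` with `κ` rational. A bijection onto the natural numbers makes
  the area of the triangle `u ≤ U` in the cone agree with `κ U²` to leading order, so that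
  `2 κ = r - l` (`two_mul_eq_of_bijOn_cone`). In terms of `α` this is a nontrivial linear equation
  with rational coefficients, contradicting irrationality.
-/

open Filter

/-! ### Integer points of the sector -/

/-- The integer points of the sector `0 ≤ y ≤ α x`, as pairs of integers. -/
def sectorPoints (α : ℝ) : Set (ℤ × ℤ) :=
  {z | 0 ≤ z.2 ∧ (z.2 : ℝ) ≤ α * z.1}

lemma eventually_nonneg_add_mul (r : ℝ) {s : ℝ} (hs : 0 < s) :
    ∀ᶠ T : ℕ in atTop, 0 ≤ r + T * s := by
  have h : Tendsto (fun T : ℕ => r + (T : ℝ) * s) atTop atTop :=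
    tendsto_atTop_add_const_left _ _ (tendsto_natCast_atTop_atTop.atTop_mul_const hs)
  exact h.eventually_ge_atTop 0

lemma eventually_mem_sectorPoints {α : ℝ} {w : ℤ × ℤ} (h0 : 0 < w.2)
    (h1 : (w.2 : ℝ) < α * w.1) (z : ℤ × ℤ) :
    ∀ᶠ T : ℕ in atTop, (z.1 + T * w.1, z.2 + T * w.2) ∈ sectorPoints α := by
  have h0' : (0 : ℝ) < w.2 := by exact_mod_cast h0
  filter_upwards [eventually_nonneg_add_mul (z.2 : ℝ) h0',
    eventually_nonneg_add_mul (α * z.1 - z.2) (sub_pos.2 h1)] with T hT1 hT2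
  refine ⟨by exact_mod_cast hT1, ?_⟩
  push_cast
  linarith

/-! ### Failure of injectivity -/

/-- Twice a quadratic polynomial with half-integral coefficients and no constant term. -/
def doubledQuadratic (a b c e f : ℤ) (z : ℤ × ℤ) : ℤ :=
  a * z.1 ^ 2 + 2 * b * z.1 * z.2 + c * z.2 ^ 2 + e * z.1 + f * z.2

/-- A conic that is not a parabola has a centre. If `J` is the (up to scaling, unique) linear map
that is skew for the polar form, then `J²` is a scalar, and the points with
position vectors `(t + J) ζ` and `(t - J) ζ` relative to the centre lie on the same conic. For
large `t` both are close in direction to `ζ`, hence in the sector. -/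
lemma not_injOn_of_disc_ne_zero {α : ℝ} (hα : 0 < α) {a b c : ℤ} (e f : ℤ)
    (hD : b ^ 2 - a * c ≠ 0) :
    ¬ Set.InjOn (doubledQuadratic a b c e f) (sectorPoints α) := by
  intro hinj
  set D := b ^ 2 - a * c with hDdef
  have hD2 : 0 < D ^ 2 := by positivity
  -- The vector `w` below is `2 D²` times the position vector of `z = (x, y)` from the centre;
  -- choose `z` so that `w` points into the interior of the sector.
  obtain ⟨y, hy⟩ : ∃ y : ℤ, 0 < 2 * D ^ 2 * y + D * (b * e - a * f) :=
    ⟨|D * (b * e - a * f)| + 1, by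
      nlinarith [neg_abs_le (D * (b * e - a * f)), abs_nonneg (D * (b * e - a * f))]⟩
  obtain ⟨x, hx⟩ : ∃ x : ℕ, ((2 * D ^ 2 * y + D * (b * e - a * f) : ℤ) : ℝ) <
      α * ((2 * D ^ 2 * x + D * (b * f - c * e) : ℤ) : ℝ) := by
    have hs : 0 < α * (2 * (D : ℝ) ^ 2) := by
      have : (0 : ℝ) < (D : ℝ) ^ 2 := by exact_mod_cast hD2
      positivity
    obtain ⟨x, hx⟩ := (eventually_nonneg_add_mul (α * (D * (b * f - c * e) : ℤ) -
      ((2 * D ^ 2 * y + D * (b * e - a * f) : ℤ) : ℝ) - 1) hs).exists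
    refine ⟨x, ?_⟩
    push_cast at hx ⊢
    linarith
  set g₁ := 2 * a * x + 2 * b * y + e with hg₁
  set g₂ := 2 * b * x + 2 * c * y + f with hg₂
  set w : ℤ × ℤ :=
    (2 * D ^ 2 * x + D * (b * f - c * e), 2 * D ^ 2 * y + D * (b * e - a * f)) with hw
  have hw1 : w.1 = D * (b * g₂ - c * g₁) := by
    simp only [hw, hg₁, hg₂, hDdef]; ring
  have hw2 : w.2 = D * (b * g₁ - a * g₂) := by
    simp only [hw, hg₁, hg₂, hDdef]; ring
  obtain ⟨T, hT1, hT2⟩ :=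
    ((eventually_mem_sectorPoints (w := w) hy hx (x - g₂, y + g₁)).and
      (eventually_mem_sectorPoints (w := w) hy hx (x + g₂, y - g₁))).exists
  have heq := hinj hT1 hT2 (by
    simp only [doubledQuadratic, hw1, hw2, hg₁, hg₂]
    ring)
  simp only [Prod.mk.injEq] at heq
  have e1 : g₁ = 0 := by linarith [heq.2]
  have e2 : g₂ = 0 := by linarith [heq.1]
  have hy' : 0 < w.2 := hy
  rw [hw2, e1, e2] at hy'
  simp at hy'

/-- If the quadratic part degenerates along a lattice direction `d` inside the sector, then the
polynomial is affine along `d`, and a shift transverse to `d` can be compensated by a shift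
along `d`. -/
lemma not_injOn_of_kernel_mem {α : ℝ} {a b c : ℤ} (e f : ℤ) {d : ℤ × ℤ}
    (h1 : a * d.1 + b * d.2 = 0) (h2 : b * d.1 + c * d.2 = 0)
    (hd1 : 0 < d.1) (hd2 : 0 ≤ d.2) (hd : (d.2 : ℝ) < α * d.1) :
    ¬ Set.InjOn (doubledQuadratic a b c e f) (sectorPoints α) := by
  intro hinj
  have hlin : ∀ m t : ℤ,
      doubledQuadratic a b c e f (t * d.1, m + t * d.2) =
        c * m ^ 2 + f * m + t * (e * d.1 + f * d.2) := by
    intro m t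
    simp only [doubledQuadratic]
    linear_combination (t ^ 2 * d.1) * h1 + (t ^ 2 * d.2 + 2 * t * m) * h2
  have hmem : ∀ t : ℤ, 0 ≤ t → (t * d.1, 0 + t * d.2) ∈ sectorPoints α := by
    intro t ht
    have ht' : (0 : ℝ) ≤ t := by exact_mod_cast ht
    refine ⟨by simpa using mul_nonneg ht hd2, ?_⟩
    push_cast
    nlinarith [mul_le_mul_of_nonneg_left hd.le ht']
  set γ := e * d.1 + f * d.2 with hγ
  by_cases h0 : γ = 0
  · have := hinj (hmem 0 le_rfl) (hmem 1 zero_le_one) (by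
      rw [hlin 0, hlin 0, h0]; ring)
    simp only [Prod.mk.injEq] at this
    omega
  · -- The transverse shift `M = γ²` changes the value by a multiple `k γ` of `γ`.
    set k := c * γ ^ 3 + f * γ with hk
    obtain ⟨t, ht1, ht2⟩ := ((eventually_nonneg_add_mul (-(γ ^ 2 : ℤ) : ℝ)
      (sub_pos.2 hd)).and (eventually_ge_atTop k.natAbs)).exists
    have hm : ((t : ℤ) * d.1, γ ^ 2 + (t : ℤ) * d.2) ∈ sectorPoints α := by
      refine ⟨by positivity, ?_⟩
      push_cast at ht1 ⊢
      linarith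
    have := hinj hm (hmem (t + k) (by omega)) (by
      rw [hlin (γ ^ 2), hlin 0, hk]; ring)
    simp only [Prod.mk.injEq] at this
    have hk0 : k = 0 := by
      have h := this.1
      have : k * d.1 = 0 := by linarith
      rcases mul_eq_zero.1 this with h | h
      · exact h
      · omega
    have h := this.2
    rw [hk0] at h
    have : γ ^ 2 = 0 := by linarith
    exact h0 (by simpa using this)

/-! ### Counting lattice points in a triangle -/

/-- The lattice points of the cone `l u ≤ v ≤ r u` with `0 ≤ u ≤ U`. -/
noncomputable def trianglePoints (l r : ℝ) (U : ℕ) : Finset (Σ _ : ℕ, ℤ) :=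
  (Finset.range (U + 1)).sigma fun u => Finset.Icc ⌈l * u⌉ ⌊r * u⌋

lemma mem_trianglePoints {l r : ℝ} {U : ℕ} {z : Σ _ : ℕ, ℤ} :
    z ∈ trianglePoints l r U ↔ z.1 ≤ U ∧ l * z.1 ≤ z.2 ∧ (z.2 : ℝ) ≤ r * z.1 := by
  simp [trianglePoints, Int.ceil_le, Int.le_floor]

lemma abs_card_Icc_ceil_floor_sub_le {x y : ℝ} (h : x ≤ y) :
    |((Finset.Icc ⌈x⌉ ⌊y⌋).card : ℝ) - (y - x)| ≤ 1 := by
  have h1 : ⌈x⌉ ≤ ⌊y⌋ + 1 := by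
    rw [Int.ceil_le]; push_cast; linarith [Int.lt_floor_add_one y]
  have h2 : ((Finset.Icc ⌈x⌉ ⌊y⌋).card : ℤ) = ⌊y⌋ + 1 - ⌈x⌉ := by
    rw [Int.card_Icc]; omega
  have h3 : ((Finset.Icc ⌈x⌉ ⌊y⌋).card : ℝ) = ⌊y⌋ + 1 - ⌈x⌉ := by exact_mod_cast h2
  rw [h3, abs_le]
  constructor <;>
    linarith [Int.floor_le y, Int.lt_floor_add_one y, Int.le_ceil x, Int.ceil_lt_add_one x]

lemma abs_card_trianglePoints_sub_le {l r : ℝ} (h : l ≤ r) (U : ℕ) :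
    |((trianglePoints l r U).card : ℝ) - (r - l) / 2 * (U * (U + 1))| ≤ U + 1 := by
  have hsum : (r - l) / 2 * (U * (U + 1)) =
      ∑ u ∈ Finset.range (U + 1), (r * (u : ℝ) - l * u) := by
    induction U with
    | zero => simp
    | succ n ih => rw [Finset.sum_range_succ, ← ih]; push_cast; ring
  rw [trianglePoints, Finset.card_sigma, hsum, Nat.cast_sum, ← Finset.sum_sub_distrib]
  refine (Finset.abs_sum_le_sum_abs _ _).trans ?_
  refine (Finset.sum_le_card_nsmul _ _ 1 fun u _ => ?_).trans (by simp)
  exact abs_card_Icc_ceil_floor_sub_le (by gcongr)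

lemma le_of_eventually_mul_sq_le {A B C : ℝ}
    (h : ∀ᶠ U : ℕ in atTop, A * (U : ℝ) ^ 2 ≤ B * (U : ℝ) ^ 2 + C * (U + 1)) : A ≤ B := by
  by_contra! hlt
  obtain ⟨U, hU, h1, h2⟩ := (h.and ((eventually_nonneg_add_mul (-(2 * |C| + 1))
    (sub_pos.2 hlt)).and (eventually_ge_atTop 1))).exists
  have hU1 : (1 : ℝ) ≤ U := by exact_mod_cast h2
  have h3 : C * (U + 1) ≤ |C| * (2 * U) :=
    mul_le_mul (le_abs_self C) (by linarith) (by linarith) (abs_nonneg C)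
  nlinarith [mul_nonneg (by linarith : (0 : ℝ) ≤ U) h1]

/-- A polynomial with quadratic part `κ u²` that enumerates the lattice points of a cone
`l u ≤ v ≤ r u` must have `κ` equal to half of the width `r - l`: up to `O(U)`, the points with
`u ≤ U` are those with value at most `κ U²`, and their number is `(r - l) U² / 2`. -/
lemma two_mul_eq_of_bijOn_cone {κ β γ δ l r : ℝ} (hlr : l < r)
    (h : Set.BijOn (fun z : ℤ × ℤ => κ * (z.1 : ℝ) ^ 2 + β * z.1 + γ * z.2 + δ)
      {z | l * z.1 ≤ z.2 ∧ (z.2 : ℝ) ≤ r * z.1} (Set.range ((↑) : ℕ → ℝ))) :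
    2 * κ = r - l := by
  -- On the cone the lower-order terms are at most `K (u + 1)` in absolute value.
  set K := |β| + |γ| * (|l| + |r|) + |δ| with hK
  have hK0 : 0 ≤ K := by positivity
  have hbound : ∀ (u : ℕ) (v : ℤ), l * u ≤ v → (v : ℝ) ≤ r * u →
      |β * u + γ * v + δ| ≤ K * (u + 1) := by
    intro u v hl hr
    have hu : (0 : ℝ) ≤ u := u.cast_nonneg
    have hv : |(v : ℝ)| ≤ (|l| + |r|) * u := by
      rw [abs_le]
      constructor
      · nlinarith [mul_le_mul_of_nonneg_right (neg_abs_le l) hu,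
          mul_nonneg (abs_nonneg r) hu]
      · nlinarith [mul_le_mul_of_nonneg_right (le_abs_self r) hu,
          mul_nonneg (abs_nonneg l) hu]
    calc |β * u + γ * v + δ| ≤ |β * u| + |γ * v| + |δ| := abs_add_three _ _ _
      _ = |β| * u + |γ| * |(v : ℝ)| + |δ| := by rw [abs_mul, abs_mul, Nat.abs_cast]
      _ ≤ |β| * u + |γ| * ((|l| + |r|) * u) + |δ| := by gcongr
      _ ≤ K * (u + 1) := by
        have h1 : 0 ≤ |β| + |γ| * (|l| + |r|) := by positivity
        have h2 := mul_nonneg (abs_nonneg δ) hu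
        rw [hK]; nlinarith
  have hnat : ∀ z : Σ _ : ℕ, ℤ, l * z.1 ≤ z.2 → (z.2 : ℝ) ≤ r * z.1 →
      ∃ n : ℕ, (n : ℝ) = κ * (z.1 : ℝ) ^ 2 + β * z.1 + γ * z.2 + δ := fun z hl hr => by
    simpa using h.mapsTo (show ((z.1 : ℤ), z.2) ∈ _ from ⟨by simpa using hl, by simpa using hr⟩)
  -- The first coordinate is nonnegative on the cone.
  have hnn : ∀ z : ℤ × ℤ, l * z.1 ≤ z.2 → (z.2 : ℝ) ≤ r * z.1 → 0 ≤ z.1 := by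
    intro z hl hr
    have : (0 : ℝ) ≤ z.1 := by
      by_contra! hneg
      nlinarith
    exact_mod_cast this
  have hcard := abs_card_trianglePoints_sub_le hlr.le
  have hupper : (r - l) / 2 ≤ max κ 0 := by
    refine le_of_eventually_mul_sq_le (C := K + 2) (Eventually.of_forall fun U => ?_)
    have hle : (trianglePoints l r U).card ≤
        (Finset.range (⌊max κ 0 * (U : ℝ) ^ 2 + K * (U + 1)⌋₊ + 1)).card := by
      refine Finset.card_le_card_of_injOn
        (fun z => ⌊κ * (z.1 : ℝ) ^ 2 + β * z.1 + γ * z.2 + δ⌋₊) ?_ ?_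
      · intro z hz
        obtain ⟨hzU, hl, hr⟩ := mem_trianglePoints.1 hz
        have hzU' : (z.1 : ℝ) ≤ U := by exact_mod_cast hzU
        have hb := (abs_le.1 (hbound z.1 z.2 hl hr)).2
        simp only [Finset.coe_range, Set.mem_Iio, Nat.lt_succ_iff]
        refine Nat.floor_le_floor ?_
        have h1 : κ * (z.1 : ℝ) ^ 2 ≤ max κ 0 * (U : ℝ) ^ 2 := by
          gcongr
          exact le_max_left _ _
        have h2 : K * ((z.1 : ℝ) + 1) ≤ K * (U + 1) := by gcongr
        linarith
      · intro z hz z' hz' heq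
        obtain ⟨-, hl, hr⟩ := mem_trianglePoints.1 hz
        obtain ⟨-, hl', hr'⟩ := mem_trianglePoints.1 hz'
        obtain ⟨n, hn⟩ := hnat z hl hr
        obtain ⟨n', hn'⟩ := hnat z' hl' hr'
        simp only [← hn, ← hn', Nat.floor_natCast] at heq
        have := h.injOn (show ((z.1 : ℤ), z.2) ∈ _ from ⟨by simpa using hl, by simpa using hr⟩)
          (show ((z'.1 : ℤ), z'.2) ∈ _ from ⟨by simpa using hl', by simpa using hr'⟩)
          (by simp only [Int.cast_natCast]; rw [← hn, ← hn', heq])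
        simp only [Prod.mk.injEq, Nat.cast_inj] at this
        exact Sigma.ext this.1 (heq_of_eq this.2)
    rw [Finset.card_range] at hle
    have hle' : ((trianglePoints l r U).card : ℝ) ≤ max κ 0 * (U : ℝ) ^ 2 + K * (U + 1) + 1 := by
      refine (Nat.cast_le.2 hle).trans ?_
      push_cast
      gcongr
      exact Nat.floor_le (by positivity)
    have h1 := (abs_le.1 (hcard U)).1
    have h2 : 0 ≤ (r - l) / 2 * U := mul_nonneg (by linarith) U.cast_nonneg
    have h3 : (0 : ℝ) ≤ U := U.cast_nonneg
    nlinarith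
  have hκ : 0 < κ := by
    by_contra! hle
    rw [max_eq_right hle] at hupper
    linarith
  have hlower : κ ≤ (r - l) / 2 := by
    refine le_of_eventually_mul_sq_le (C := K + 1 + (r - l) / 2) ?_
    filter_upwards [eventually_nonneg_add_mul (-K) hκ] with U hU
    -- Beyond `u = U` all values exceed `κ U² - K (U + 1)`.
    have hle : (Finset.range ⌈κ * (U : ℝ) ^ 2 - K * (U + 1)⌉₊).card ≤
        (trianglePoints l r U).card := by
      refine Finset.card_le_card_of_surjOn
        (fun z => ⌊κ * (z.1 : ℝ) ^ 2 + β * z.1 + γ * z.2 + δ⌋₊) ?_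
      intro n hn
      simp only [Finset.coe_range, Set.mem_Iio, Nat.lt_ceil] at hn
      obtain ⟨⟨u, v⟩, ⟨hl, hr⟩, hz⟩ := h.surjOn (Set.mem_range_self n)
      simp only at hl hr hz
      obtain ⟨m, rfl⟩ := Int.eq_ofNat_of_zero_le (hnn (u, v) hl hr)
      simp only [Int.cast_natCast] at hl hr hz
      refine ⟨⟨m, v⟩, Finset.mem_coe.2 (mem_trianglePoints.2 ⟨?_, hl, hr⟩), ?_⟩
      · by_contra! hlt
        have hlt' : (U : ℝ) < m := by exact_mod_cast hlt
        have hb := (abs_le.1 (hbound m v hl hr)).1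
        have h0 : (0 : ℝ) ≤ U := U.cast_nonneg
        have h1 : 0 ≤ κ * (m + U) - K := by nlinarith
        have h2 := mul_nonneg (sub_nonneg.2 hlt'.le) h1
        nlinarith
      · simp only [hz, Nat.floor_natCast]
    rw [Finset.card_range] at hle
    have hle' : κ * (U : ℝ) ^ 2 - K * (U + 1) ≤ (trianglePoints l r U).card :=
      (Nat.le_ceil _).trans (Nat.cast_le.2 hle)
    have h1 := (abs_le.1 (hcard U)).2
    nlinarith
  rw [max_eq_left hκ.le] at hupper
  linarith

/-! ### Coefficients of quadratic packing polynomials -/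

lemma MvPolynomial.exists_eval_eq_of_totalDegree_le_two {P : MvPolynomial (Fin 2) ℝ}
    (hP : P.totalDegree ≤ 2) :
    ∃ A B C E F G : ℝ, ∀ x y : ℝ, MvPolynomial.eval ![x, y] P =
      A * x ^ 2 + B * x * y + C * y ^ 2 + E * x + F * y + G := by
  have hdeg : ∀ d ∈ P.support, d 0 + d 1 ≤ 2 := fun d hd => by
    have := (MvPolynomial.le_totalDegree hd).trans hP
    rwa [Finsupp.sum_fintype _ _ (fun _ => rfl), Fin.sum_univ_two] at this
  have hsum : ∀ s : Finset (Fin 2 →₀ ℕ), (∀ d ∈ s, d 0 + d 1 ≤ 2) →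
      ∃ A B C E F G : ℝ, ∀ x y : ℝ, ∑ d ∈ s, P.coeff d * (x ^ d 0 * y ^ d 1) =
        A * x ^ 2 + B * x * y + C * y ^ 2 + E * x + F * y + G := by
    intro s
    induction s using Finset.induction_on with
    | empty => exact fun _ => ⟨0, 0, 0, 0, 0, 0, by simp⟩
    | insert d s hds ih =>
      intro hs
      obtain ⟨A, B, C, E, F, G, hABC⟩ := ih fun d' hd' => hs d' (Finset.mem_insert_of_mem hd')
      have hd := hs d (Finset.mem_insert_self d s)
      simp only [Finset.sum_insert hds, hABC]
      set t := P.coeff d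
      generalize d 0 = i at hd ⊢
      generalize d 1 = j at hd ⊢
      have hi : i ≤ 2 := by omega
      have hj : j ≤ 2 := by omega
      interval_cases i <;> interval_cases j
      · exact ⟨A, B, C, E, F, G + t, fun x y => by ring⟩
      · exact ⟨A, B, C, E, F + t, G, fun x y => by ring⟩
      · exact ⟨A, B, C + t, E, F, G, fun x y => by ring⟩
      · exact ⟨A, B, C, E + t, F, G, fun x y => by ring⟩
      · exact ⟨A, B + t, C, E, F, G, fun x y => by ring⟩
      · omega
      · exact ⟨A + t, B, C, E, F, G, fun x y => by ring⟩
      · omega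
      · omega
  obtain ⟨A, B, C, E, F, G, h⟩ := hsum P.support hdeg
  exact ⟨A, B, C, E, F, G, fun x y => by simp [MvPolynomial.eval_eq', Fin.prod_univ_two, ← h x y]⟩

lemma IsPackingPolynomial.bijOn_sectorPoints {α : ℝ} {P : MvPolynomial (Fin 2) ℝ}
    (hP : IsPackingPolynomial α P) :
    Set.BijOn (fun z : ℤ × ℤ => MvPolynomial.eval ![(z.1 : ℝ), (z.2 : ℝ)] P) (sectorPoints α)
      (Set.range ((↑) : ℕ → ℝ)) := by
  have hcast : Set.BijOn (fun z : ℤ × ℤ => ((z.1 : ℝ), (z.2 : ℝ))) (sectorPoints α)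
      (sector α ∩ integerLattice) := by
    refine ⟨fun z hz => ⟨⟨Int.cast_nonneg hz.1, hz.2⟩, z, rfl⟩, fun z _ z' _ h => ?_, ?_⟩
    · simpa [Prod.ext_iff] using h
    · rintro _ ⟨⟨h1, h2⟩, z, rfl⟩
      exact ⟨z, ⟨Int.cast_nonneg_iff.1 h1, h2⟩, rfl⟩
  have h := Set.BijOn.comp hP hcast
  exact h

/-- A quadratic polynomial with integral values at the integer points of a sector has
half-integral coefficients, except for the constant term, as follows by taking differences. -/
lemma exists_doubledQuadratic_of_mapsTo {α : ℝ} (hα : 0 < α) {A B C E F G : ℝ}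
    (h : ∀ z ∈ sectorPoints α, ∃ n : ℤ, (n : ℝ) = A * (z.1 : ℝ) ^ 2 + B * z.1 * z.2 +
      C * (z.2 : ℝ) ^ 2 + E * z.1 + F * z.2 + G) :
    ∃ a b c e f : ℤ, 2 * A = a ∧ B = b ∧ 2 * C = c ∧ 2 * E = e ∧ 2 * F = f := by
  obtain ⟨k, hk⟩ : ∃ k : ℕ, 2 ≤ α * k := by
    obtain ⟨k, hk⟩ := (eventually_nonneg_add_mul (-2) hα).exists
    exact ⟨k, by linarith⟩
  have hmem : ∀ i j : ℕ, j ≤ 2 → (((k + i : ℕ) : ℤ), (j : ℤ)) ∈ sectorPoints α := by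
    intro i j hj
    have hj' : (j : ℝ) ≤ 2 := by exact_mod_cast hj
    have : 0 ≤ α * i := by positivity
    refine ⟨by positivity, ?_⟩
    push_cast
    linarith
  obtain ⟨n00, h00⟩ := h _ (hmem 0 0 (by norm_num))
  obtain ⟨n10, h10⟩ := h _ (hmem 1 0 (by norm_num))
  obtain ⟨n20, h20⟩ := h _ (hmem 2 0 (by norm_num))
  obtain ⟨n01, h01⟩ := h _ (hmem 0 1 (by norm_num))
  obtain ⟨n02, h02⟩ := h _ (hmem 0 2 (by norm_num))
  obtain ⟨n11, h11⟩ := h _ (hmem 1 1 (by norm_num))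
  push_cast at h00 h10 h20 h01 h02 h11
  have hA : 2 * A = ((n20 - 2 * n10 + n00 : ℤ) : ℝ) := by
    push_cast; rw [h00, h10, h20]; ring
  have hB : B = ((n11 - n10 - n01 + n00 : ℤ) : ℝ) := by
    push_cast; rw [h00, h10, h01, h11]; ring
  have hC : 2 * C = ((n02 - 2 * n01 + n00 : ℤ) : ℝ) := by
    push_cast; rw [h00, h01, h02]; ring
  refine ⟨_, _, _, 2 * (n10 - n00) - (2 * k + 1) * (n20 - 2 * n10 + n00),
    2 * (n01 - n00) - (n02 - 2 * n01 + n00) - 2 * k * (n11 - n10 - n01 + n00), hA, hB, hC, ?_, ?_⟩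
  · push_cast; rw [h00, h10, h20]; ring
  · push_cast; rw [h00, h10, h01, h02, h11]; ring

/-! ### The parabolic case and the conclusion -/

/-- Unimodular coordinates `u = p x + q y`, `v = t x - s y` on the integer points of a sector on
which `p x + q y` is positive. -/
lemma bijOn_cone_sectorPoints {α : ℝ} {p q s t : ℤ} (hp : 0 < p)
    (hpq : 0 < p + α * q) (hst : p * s + q * t = 1) :
    Set.BijOn (fun z : ℤ × ℤ => (s * z.1 + q * z.2, t * z.1 - p * z.2))
      {z | (t - α * s) / (p + α * q) * z.1 ≤ z.2 ∧ (z.2 : ℝ) ≤ t / p * z.1}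
      (sectorPoints α) := by
  have hp' : (0 : ℝ) < p := by exact_mod_cast hp
  have hst' : (p * s + q * t : ℝ) = 1 := by exact_mod_cast hst
  have hmem : ∀ z : ℤ × ℤ, ((t - α * s) / (p + α * q) * z.1 ≤ z.2 ∧ (z.2 : ℝ) ≤ t / p * z.1) ↔
      (s * z.1 + q * z.2, t * z.1 - p * z.2) ∈ sectorPoints α := by
    intro z
    rw [div_mul_eq_mul_div, div_mul_eq_mul_div, div_le_iff₀ hpq, le_div_iff₀ hp', and_comm]
    refine and_congr ?_ ?_
    · rw [← Int.cast_nonneg_iff (R := ℝ)]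
      push_cast
      constructor <;> intro h <;> linarith
    · push_cast
      constructor <;> intro h <;> linarith
  refine ⟨fun z hz => (hmem z).1 hz, fun z _ z' _ h => ?_, fun w hw => ?_⟩
  · simp only [Prod.mk.injEq] at h
    obtain ⟨h1, h2⟩ := h
    ext
    · linear_combination p * h1 + q * h2 + (z'.1 - z.1) * hst
    · linear_combination t * h1 - s * h2 + (z'.2 - z.2) * hst
  · have hw' : (s * (p * w.1 + q * w.2) + q * (t * w.1 - s * w.2),
        t * (p * w.1 + q * w.2) - p * (t * w.1 - s * w.2)) = w := by
      ext
      · linear_combination w.1 * hst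
      · linear_combination w.2 * hst
    refine ⟨(p * w.1 + q * w.2, t * w.1 - s * w.2), (hmem _).2 ?_, hw'⟩
    simpa only [hw'] using hw

/-- If the quadratic part is a multiple of the square of a linear form `i x + j y` that is
positive on the sector, then comparing the growth of the polynomial with the number of lattice
points determines `κ` in terms of `α`. For rational `κ` this is a linear equation for `α` with
rational coefficients. -/
lemma linear_relation_of_parabolic {α : ℝ} (hα : 0 < α) {i j : ℤ} (hi : 0 < i)
    (hij : 0 < i + α * j) {κ E F G : ℝ}
    (h : Set.BijOn (fun z : ℤ × ℤ => κ * (i * z.1 + j * z.2 : ℝ) ^ 2 + E * z.1 + F * z.2 + G)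
      (sectorPoints α) (Set.range ((↑) : ℕ → ℝ))) :
    2 * κ * i * (i + α * j) = α := by
  obtain ⟨g, hg⟩ : ∃ g : ℤ, g = Int.gcd i j := ⟨_, rfl⟩
  have hg0 : 0 < g := by
    rw [hg]; exact_mod_cast Int.gcd_pos_of_ne_zero_left _ hi.ne'
  obtain ⟨p, hp⟩ : g ∣ i := hg ▸ Int.gcd_dvd_left _ _
  obtain ⟨q, hq⟩ : g ∣ j := hg ▸ Int.gcd_dvd_right _ _
  have hbez : p * Int.gcdA i j + q * Int.gcdB i j = 1 := by
    have h1 := Int.gcd_eq_gcd_ab i j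
    rw [← hg] at h1
    refine mul_left_cancel₀ hg0.ne' ?_
    linear_combination -h1 - Int.gcdA i j * hp - Int.gcdB i j * hq
  set s := Int.gcdA i j
  set t := Int.gcdB i j
  have hg0' : (0 : ℝ) < g := by exact_mod_cast hg0
  have hp0 : 0 < p := pos_of_mul_pos_right (hp ▸ hi) hg0.le
  have hp0' : (0 : ℝ) < p := by exact_mod_cast hp0
  have hpR : (i : ℝ) = g * p := by exact_mod_cast hp
  have hqR : (j : ℝ) = g * q := by exact_mod_cast hq
  have hbezR : (p * s + q * t : ℝ) = 1 := by exact_mod_cast hbez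
  have hpq : 0 < p + α * q := by
    refine pos_of_mul_pos_right (a := (g : ℝ)) ?_ hg0'.le
    rw [hpR, hqR] at hij
    linarith
  have hwidth : (t : ℝ) / p - (t - α * s) / (p + α * q) = α / (p * (p + α * q)) := by
    field_simp
    linear_combination α * hbezR
  have hlt : (t - α * s) / (p + α * q) < (t : ℝ) / p := by
    rw [← sub_pos, hwidth]; positivity
  have hcomp := h.comp (bijOn_cone_sectorPoints hp0 hpq hbez)
  have := two_mul_eq_of_bijOn_cone (κ := κ * g ^ 2) (β := E * s + F * t) (γ := E * q - F * p)
    (δ := G) hlt (hcomp.congr fun z _ => by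
      simp only [Function.comp_apply]
      push_cast
      rw [hpR, hqR]
      have : (g * p * (s * z.1 + q * z.2) + g * q * (t * z.1 - p * z.2) : ℝ) = g * z.1 := by
        linear_combination g * z.1 * hbezR
      rw [this]
      ring)
  rw [hwidth, eq_div_iff (by positivity)] at this
  rw [hpR, hqR]
  linear_combination this

theorem corollary3 (α : ℝ) (hα : 0 < α) (hirr : Irrational α) :
    ¬ ∃ P : MvPolynomial (Fin 2) ℝ, IsQuadraticPackingPolynomial α P := by
  rintro ⟨P, hdeg, hP⟩
  obtain ⟨A, B, C, E, F, G, heval⟩ :=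
    MvPolynomial.exists_eval_eq_of_totalDegree_le_two hdeg.le
  have hbij := hP.bijOn_sectorPoints
  simp only [heval] at hbij
  obtain ⟨a, b, c, e, f, hA, hB, hC, hE, hF⟩ := exists_doubledQuadratic_of_mapsTo hα
    fun z hz => by
      obtain ⟨n, hn⟩ := hbij.mapsTo hz
      exact ⟨n, by exact_mod_cast hn⟩
  have hdouble : ∀ z : ℤ × ℤ, A * (z.1 : ℝ) ^ 2 + B * z.1 * z.2 + C * (z.2 : ℝ) ^ 2 +
      E * z.1 + F * z.2 + G = (doubledQuadratic a b c e f z : ℝ) / 2 + G := by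
    intro z
    simp only [doubledQuadratic]
    push_cast
    rw [← hA, ← hB, ← hC, ← hE, ← hF]
    ring
  have hinj : Set.InjOn (doubledQuadratic a b c e f) (sectorPoints α) :=
    fun z hz z' hz' hzz => hbij.injOn hz hz' (by simp only [hdouble, hzz])
  have hD : b ^ 2 - a * c = 0 := by
    by_contra hD
    exact not_injOn_of_disc_ne_zero hα e f hD hinj
  have ha : a ≠ 0 := by
    rintro rfl
    obtain rfl : b = 0 := by simpa using hD
    exact not_injOn_of_kernel_mem (d := (1, 0)) e f (by simp) (by simp)
      (by simp) (by simp) (by simpa using hα) hinj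
  -- `2 P₂ = (i x + j y)² / a`, with the sign chosen so that `0 < i`.
  obtain ⟨σ, hσ, hσa⟩ : ∃ σ : ℤ, σ ^ 2 = 1 ∧ 0 < σ * a := by
    rcases lt_or_gt_of_ne ha with h | h
    · exact ⟨-1, by norm_num, by linarith⟩
    · exact ⟨1, by norm_num, by linarith⟩
  have haR : (a : ℝ) ≠ 0 := by exact_mod_cast ha
  have hσR : (σ : ℝ) ^ 2 = 1 := by exact_mod_cast hσ
  have hDR : (b : ℝ) ^ 2 - a * c = 0 := by exact_mod_cast hD
  rcases lt_or_ge 0 (((σ * a : ℤ) : ℝ) + α * ((σ * b : ℤ) : ℝ)) with hpos | hneg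
  · have hrel := linear_relation_of_parabolic (κ := 1 / (2 * a)) (E := E) (F := F) (G := G)
      hα hσa hpos (hbij.congr fun z _ => by
        push_cast
        have hA' : A = a / 2 := by linarith
        have hC' : C = c / 2 := by linarith
        simp only [hA', hB, hC']
        field_simp
        linear_combination (-(a * z.1 + b * z.2 : ℝ) ^ 2) * hσR - (z.2 : ℝ) ^ 2 * hDR)
    have hrel' : (a : ℝ) = α * (1 - b) := by
      push_cast at hrel
      field_simp at hrel
      linear_combination hrel - (a + α * b) * hσR
    have hb : (1 - b : ℝ) ≠ 0 := by
      intro h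
      exact haR (by rw [hrel', h, mul_zero])
    exact hirr ⟨(a : ℚ) / (1 - b), by push_cast; rw [hrel']; field_simp⟩
  · have hne : ((σ * a : ℤ) : ℝ) + α * ((σ * b : ℤ) : ℝ) ≠ 0 := by
      intro h
      have hb : ((σ * b : ℤ) : ℝ) ≠ 0 := by
        intro hb
        rw [hb, mul_zero, add_zero] at h
        exact hσa.ne' (by exact_mod_cast h)
      exact hirr ⟨-((σ * a : ℤ) : ℚ) / ((σ * b : ℤ) : ℚ), by
        rw [Rat.cast_div, Rat.cast_neg, Rat.cast_intCast, Rat.cast_intCast, div_eq_iff hb]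
        linarith⟩
    have hlt := lt_of_le_of_ne hneg hne
    have hσaR : (0 : ℝ) < ((σ * a : ℤ) : ℝ) := by exact_mod_cast hσa
    refine not_injOn_of_kernel_mem (d := (-(σ * b), σ * a)) e f (by ring)
      (by linear_combination (-σ) * hD) ?_ hσa.le ?_ hinj
    · have : ((σ * b : ℤ) : ℝ) < 0 := by
        by_contra! h
        nlinarith [mul_nonneg hα.le h]
      have : σ * b < 0 := by exact_mod_cast this
      simpa using this
    · push_cast at hlt ⊢
      linarith
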